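/- **Setting.** Let $\nu,\nu^\star$ be probability measures on $\mathbb R^n$ and let $h_0,h_1,h_1^\star:\mathbb R^n\to\mathbb R^n$ be measurable. Put $\mu_0=(h_0)_\#\nu$, $\mu_1=(h_1)_\#\nu$, $\mu_0^\star=(h_0)_\#\nu^\star$, $\mu_1^\star=(h_1^\star)_\#\nu^\star$ and $\mu_1^\dagger=(h_1)_\#\nu^\star$. **Terminology.** A measure is *supported on* a convex set $K$ if $K$ carries all its mass and every point of $K$ lies in its topological support; it is supported on a finite set $F$ if $F$ carries all its mass. Maps $h,g:\mathbb R^n\to\mathbb R^n$ are *co-monotone* if $\langle h(x)-h(y),g(x)-g(y)\rangle\ge 0$ for all $x,y$, and $g\circ h^{-1}$ is *well defined* if $h(x)=h(y)$ implies $g(x)=g(y)$. A map $T$ is *cyclically monotone* on $K$ if $\sum_{i=1}^m\|u_i-T(u_i)\|^2\le\sum_{i=1}^m\|u_i-T(u_{i+1})\|^2$ for all $m\ge1$ and all $u_1,\dots,u_m\in K$, $u_{m+1}=u_1$. The *Brenier map* from $P$ to $Q$ is the $P$-almost everywhere unique map which is $P$-almost everywhere the gradient of a convex function $\varphi:\mathbb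 R^n\to\mathbb R\cup\{+\infty\}$ and pushes $P$ forward to $Q$. **Assumptions.** - (A.1) $\mu_0$ and $\mu_0^\star$ are absolutely continuous with respect to Lebesgue measure and supported on convex sets $K_0$ and $K_0^\star$, respectively. - (A.2) $\mu_1$ and $\mu_1^\dagger$ are supported on finite sets $F_1$ and $F_1^\dagger$, respectively. - (A.3) $h_0$ and $h_1$ are co-monotone and $h_1\circ h_0^{-1}$ is well defined. - (A.4) $h_0$ and $h_1^\star$ are co-monotone and $h_1^\star\circ h_0^{-1}$ is well defined. - (A.5) $\mu_1^\star$ is absolutely continuous with respect to Lebesgue measure and supported on a convex set $K_1^\star$. **Theorem.** (1) Under (A.1)–(A.3) there is a map $\mathsf d$ on $\mathbb R^n$ with $\mathsf d\circ h_0=h_1$ $\nu$-a.e. and $\nu^\star$-a.e. (that is, $\mathsf d=h_1\circ h_0^{-1}$) such that - $\mathsf d$ maps $K_0^\star$ into $F_1^\dagger$, is cyclically monotone on $K_0^\star$, and $\mu_1^\dagger=\mathsf d_\#\mu_0^\star$; every map with these three properties equals $\mathsf d$ $\mu_0^\star$-a.e., and $\mathsf d$ is the Brenier map from $\mu_0^\star$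 to $\mu_1^\dagger$; - $\mathsf d$ is the Brenier map from $\mu_0$ to $\mu_1$; moreover, if $\varphi$ is convex, finite and differentiable at $\mu_0$-almost every point (finite in a neighbourhood of it), and $(\nabla\varphi)_\#\mu_0=\mu_1$, then $\nabla\varphi=\mathsf d$ also $\mu_0^\star$-a.e. on $K_0$. (2) If in addition (A.4)–(A.5) hold, there is a map $\mathsf T$ on $\mathbb R^n$ that maps $K_1^\star$ into $F_1^\dagger$, is cyclically monotone on $K_1^\star$ and satisfies $\mu_1^\dagger=\mathsf T_\#\mu_1^\star$; every map with these three properties equals $\mathsf T$ $\mu_1^\star$-a.e., and $\mathsf T$ is the Brenier map from $\mu_1^\star$ to $\mu_1^\dagger$. -/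

import Mathlib

/-! A monotone map `T` with finitely many values on a convex set `K` is locally the gradient of a
maximum of affine functions, so its circulation along the boundary of a small triangle vanishes; by
subdivision, as in Goursat's lemma, it vanishes along every triangle. Integrating `T` along segments
then yields a convex potential: there are intercepts `c` such that `T x` maximizes
`⟪a, x⟫ + c a` among the values `a` of `T` on `K`. In particular `T` is cyclically monotone.

If two such maps `T` and `T'`, with intercepts `c` and `c'`, have the same law, then
`(c - c') ∘ T' ≤ (c - c') ∘ T` almost everywhere, and these functions also have the same law. Hence
they agree, `T` and `T'` both maximize `⟪a, x⟫ + c a`, and this maximizer is unique off finitely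
many hyperplanes. Since the gradient of a convex function also has intercepts, this argument gives
every uniqueness assertion at once.

For a co-monotone pair `h`, `g` the correspondence `g ∘ h⁻¹` extends by closure to the support of
the law of `h`; the extension is monotone and single-valued almost everywhere, and any selection of
it is the drift. The transport from an arbitrary absolutely continuous law to a finitely supported
one comes from a minimizer of the semidiscrete dual functional.
-/

open MeasureTheory Set
open scoped Gradient

/-- The Euclidean space `ℝⁿ`. -/
abbrev Rn (n : ℕ) : Type := EuclideanSpace ℝ (Fin n)

/-- `h` and `g` are co-monotone: `⟨h x - h y, g x - g y⟩ ≥ 0` for all `x`, `y`. -/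
def CoMonotone {n : ℕ} (h g : Rn n → Rn n) : Prop :=
  ∀ x y, 0 ≤ inner ℝ (h x - h y) (g x - g y)

/-- `g ∘ h⁻¹` is a well-defined function on the range of `h`. -/
def CompInvWellDefined {n : ℕ} (g h : Rn n → Rn n) : Prop :=
  ∀ x y, h x = h y → g x = g y

/-- `μ` is supported on `K`: `K` carries all the mass of `μ` and every point of `K` belongs to the
topological support of `μ` (so that `K` is the support of `μ`, up to taking closures). -/
def IsSupportedOn {n : ℕ} (μ : Measure (Rn n)) (K : Set (Rn n)) : Prop :=
  μ Kᶜ = 0 ∧ K ⊆ μ.support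

/-- `T` is cyclically monotone on `S`: along every cycle `u₀, …, uₘ, u₀` of points of `S`, matching
each `uᵢ` with `T uᵢ` costs no more than matching it with `T uᵢ₊₁`. (Addition in `Fin (m + 1)` is
cyclic.) -/
def CyclicallyMonotoneOn {n : ℕ} (T : Rn n → Rn n) (S : Set (Rn n)) : Prop :=
  ∀ (m : ℕ) (u : Fin (m + 1) → Rn n), (∀ i, u i ∈ S) →
    ∑ i, ‖u i - T (u i)‖ ^ 2 ≤ ∑ i, ‖u i - T (u (i + 1))‖ ^ 2

/-- The convex function `φ` with effective domain `C` (understood as `+∞` outside `C`) is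
differentiable `P`-almost everywhere, and its gradient pushes `P` forward to `Q`. -/
def IsBrenierPotential {n : ℕ} (P Q : Measure (Rn n)) (C : Set (Rn n)) (φ : Rn n → ℝ) : Prop :=
  ConvexOn ℝ C φ ∧ (∀ᵐ x ∂P, x ∈ interior C ∧ DifferentiableAt ℝ φ x) ∧
    AEMeasurable (∇ φ) P ∧ P.map (∇ φ) = Q

/-- `T` is, up to a `P`-null set, the gradient of a convex function that pushes `P` to `Q`. -/
def IsGradientTransport {n : ℕ} (P Q : Measure (Rn n)) (T : Rn n → Rn n) : Prop :=
  ∃ (C : Set (Rn n)) (φ : Rn n → ℝ), IsBrenierPotential P Q C φ ∧ T =ᵐ[P] ∇ φ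

/-- `T` is the Brenier map from `P` to `Q`: the `P`-almost everywhere unique gradient of a convex
function that pushes `P` forward to `Q`. -/
def IsBrenierMap {n : ℕ} (P Q : Measure (Rn n)) (T : Rn n → Rn n) : Prop :=
  IsGradientTransport P Q T ∧ ∀ S, IsGradientTransport P Q S → S =ᵐ[P] T

/-- `T` maps `K` into `F`, is cyclically monotone on `K` and pushes `P` forward to `Q`. -/
def IsMonotoneTransportOn {n : ℕ} (P Q : Measure (Rn n)) (K F : Set (Rn n))
    (T : Rn n → Rn n) : Prop :=
  MapsTo T K F ∧ CyclicallyMonotoneOn T K ∧ AEMeasurable T P ∧ P.map T = Q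

open Filter Topology AffineMap

section Subgradient

variable {E : Type*} [NormedAddCommGroup E] [InnerProductSpace ℝ E]
  {T : E → E} {φ : E → ℝ} {c : E → ℝ} {S : Set E}

/-- `T` is a selection of the subdifferential of `φ` relative to `S`. -/
def IsSubgradientOn (φ : E → ℝ) (T : E → E) (S : Set E) : Prop :=
  ∀ x ∈ S, ∀ y ∈ S, φ x + inner ℝ (T x) (y - x) ≤ φ y

/-- At each point `x` of `S`, the slope `T x` is maximal among the affine functions
`⟪T y, ·⟫ + c (T y)`, `y ∈ S`. The intercept `c` is indexed by the slope; it plays the role of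
minus the Legendre transform of a convex potential of `T`. -/
def IsMaxSlopeOn (T : E → E) (c : E → ℝ) (S : Set E) : Prop :=
  ∀ x ∈ S, ∀ y ∈ S, inner ℝ (T y) x + c (T y) ≤ inner ℝ (T x) x + c (T x)

/-- `T` is a monotone operator on `S` in the sense of Minty. -/
def MintyMonotoneOn (T : E → E) (S : Set E) : Prop :=
  ∀ x ∈ S, ∀ y ∈ S, 0 ≤ inner ℝ (T x - T y) (x - y)

theorem IsSubgradientOn.mintyMonotoneOn (h : IsSubgradientOn φ T S) : MintyMonotoneOn T S := by
  intro x hx y hy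
  have hxy := h x hx y hy
  have hyx := h y hy x hx
  simp only [inner_sub_left, inner_sub_right] at hxy hyx ⊢
  linarith

theorem IsSubgradientOn.exists_isMaxSlopeOn (h : IsSubgradientOn φ T S) :
    ∃ c, IsMaxSlopeOn T c S := by
  let p := Function.invFunOn T S
  have intercept_eq : ∀ x ∈ S, φ (p (T x)) - inner ℝ (T x) (p (T x)) = φ x - inner ℝ (T x) x := by
    intro x hx
    have hp : p (T x) ∈ S := Function.invFunOn_mem ⟨x, hx, rfl⟩
    have hTp : T (p (T x)) = T x := Function.invFunOn_eq ⟨x, hx, rfl⟩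
    have h₁ := h x hx _ hp
    have h₂ := h _ hp x hx
    rw [hTp] at h₂
    rw [inner_sub_right] at h₁ h₂
    linarith
  refine ⟨fun a ↦ φ (p a) - inner ℝ a (p a), fun x hx y hy ↦ ?_⟩
  have hyx := h y hy x hx
  rw [inner_sub_right] at hyx
  simp only [intercept_eq x hx, intercept_eq y hy]
  linarith

theorem IsMaxSlopeOn.isSubgradientOn (h : IsMaxSlopeOn T c S) :
    IsSubgradientOn (fun x ↦ inner ℝ (T x) x + c (T x)) T S := by
  intro x hx y hy
  have hyx := h y hy x hx
  simp only [inner_sub_right]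
  linarith

theorem IsMaxSlopeOn.mono {S' : Set E} (h : IsMaxSlopeOn T c S) (hS : S' ⊆ S) :
    IsMaxSlopeOn T c S' :=
  fun x hx y hy ↦ h x (hS hx) y (hS hy)

theorem exists_isMaxSlopeOn_univ {A : Set E} (hA : A.Finite) (hne : A.Nonempty) (c : E → ℝ) :
    ∃ m : E → E, (∀ x, m x ∈ A) ∧ (∀ x, ∀ a ∈ A, inner ℝ a x + c a ≤ inner ℝ (m x) x + c (m x)) ∧
      IsMaxSlopeOn m c univ := by
  choose m hmA hmax using fun x ↦ A.exists_max_image (fun a ↦ inner ℝ a x + c a) hA hne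
  exact ⟨m, hmA, hmax, fun x _ y _ ↦ hmax x _ (hmA y)⟩

theorem IsSubgradientOn.convexOn (h : IsSubgradientOn φ T S) (hS : Convex ℝ S) :
    ConvexOn ℝ S φ := by
  refine ⟨hS, fun x hx y hy s t hs ht hst ↦ ?_⟩
  set z := s • x + t • y with hz
  have hzS : z ∈ S := hS hx hy hs ht hst
  have hzero : s * inner ℝ (T z) (x - z) + t * inner ℝ (T z) (y - z) = 0 := by
    have hcomb : s • (x - z) + t • (y - z) = z - (s + t) • z := by rw [hz]; module
    rw [← real_inner_smul_right, ← real_inner_smul_right, ← inner_add_right, hcomb, hst, one_smul,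
      sub_self, inner_zero_right]
  have hx' := mul_le_mul_of_nonneg_left (h z hzS x hx) hs
  have hy' := mul_le_mul_of_nonneg_left (h z hzS y hy) ht
  have hφ : s * φ z + t * φ z = φ z := by rw [← add_mul, hst, one_mul]
  simp only [smul_eq_mul]
  linarith

theorem IsSubgradientOn.cyclicallyMonotoneOn {n : ℕ} {T : Rn n → Rn n} {φ : Rn n → ℝ}
    {S : Set (Rn n)} (h : IsSubgradientOn φ T S) : CyclicallyMonotoneOn T S := by
  intro m u hu
  have shift (f : Fin (m + 1) → ℝ) : ∑ i, f (i + 1) = ∑ i, f i :=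
    Equiv.sum_comp (Equiv.addRight (1 : Fin (m + 1))) f
  have hsum : ∑ i, (φ (u (i + 1)) + inner ℝ (T (u (i + 1))) (u i - u (i + 1))) ≤ ∑ i, φ (u i) :=
    Finset.sum_le_sum fun i _ ↦ h _ (hu (i + 1)) _ (hu i)
  have hφ := shift fun i ↦ φ (u i)
  have hself := shift fun i ↦ inner ℝ (u i) (T (u i))
  have hnorm := shift fun i ↦ ‖T (u i)‖ ^ 2
  simp only [norm_sub_sq_real, inner_sub_right, Finset.sum_add_distrib, Finset.sum_sub_distrib,
    ← Finset.mul_sum, fun x y : Rn n ↦ real_inner_comm (T x) y] at hsum hself ⊢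
  linarith

theorem CyclicallyMonotoneOn.mintyMonotoneOn {n : ℕ} {T : Rn n → Rn n} {S : Set (Rn n)}
    (h : CyclicallyMonotoneOn T S) : MintyMonotoneOn T S := by
  intro x hx y hy
  have hcycle : ∑ i : Fin 2, ‖![x, y] i - T (![x, y] i)‖ ^ 2 ≤
      ∑ i : Fin 2, ‖![x, y] i - T (![x, y] (i + 1))‖ ^ 2 :=
    h 1 ![x, y] (by simp [Fin.forall_fin_two, hx, hy])
  simp only [Fin.sum_univ_two, Fin.isValue, Matrix.cons_val_zero, Matrix.cons_val_one, zero_add,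
    show (1 : Fin 2) + 1 = 0 from rfl, norm_sub_sq_real] at hcycle
  simp only [inner_sub_left, inner_sub_right, fun z w : Rn n ↦ real_inner_comm z (T w)]
  linarith

end Subgradient

section SegmentIntegral

variable {E : Type*} [NormedAddCommGroup E] [InnerProductSpace ℝ E]
  {d : E → E} {K : Set E} {x y : E}

/-- The circulation `∫ ⟪d z, dz⟫` of the vector field `d` along the segment from `x` to `y`; it
recovers the potential of which a monotone field `d` is a subgradient. -/
noncomputable def segmentIntegral (d : E → E) (x y : E) : ℝ :=
  ∫ᶜ z in Path.segment x y, innerSL ℝ (d z)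

theorem segmentIntegral_symm (d : E → E) (x y : E) :
    segmentIntegral d y x = -segmentIntegral d x y := by
  rw [segmentIntegral, ← Path.segment_symm, curveIntegral_symm, segmentIntegral]

theorem segment_trans_segment_midpoint (x y : E) :
    (Path.segment x (midpoint ℝ x y)).trans (.segment (midpoint ℝ x y) y) = .segment x y := by
  ext t
  rw [Path.trans_apply]
  split_ifs
  all_goals
    simp only [Path.segment_apply, lineMap_apply_module, midpoint_eq_smul_add, invOf_eq_inv]
    module

theorem MintyMonotoneOn.monotoneOn_segment (hd : MintyMonotoneOn d K) (hK : Convex ℝ K)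
    (hx : x ∈ K) (hy : y ∈ K) :
    MonotoneOn (fun t : ℝ ↦ inner ℝ (d (lineMap x y t)) (y - x)) (Icc 0 1) := by
  intro s hs t ht hst
  rcases hst.eq_or_lt with rfl | hlt
  · exact le_rfl
  have hmono := hd _ (hK.lineMap_mem hx hy ht) _ (hK.lineMap_mem hx hy hs)
  have hdir : (lineMap x y t : E) - lineMap x y s = (t - s) • (y - x) := by
    simp only [lineMap_apply_module]
    module
  rw [hdir, real_inner_smul_right] at hmono
  rw [← sub_nonneg, ← inner_sub_left]
  exact nonneg_of_mul_nonneg_right hmono (sub_pos.2 hlt)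

theorem MintyMonotoneOn.curveIntegrable_segment (hd : MintyMonotoneOn d K) (hK : Convex ℝ K)
    (hx : x ∈ K) (hy : y ∈ K) :
    CurveIntegrable (fun z ↦ innerSL ℝ (d z)) (Path.segment x y) := by
  have hmono := (hd.monotoneOn_segment hK hx hy).mono (uIcc_of_le zero_le_one).subset
  simpa only [_root_.curveIntegrable_segment, innerSL_apply_apply] using hmono.intervalIntegrable

theorem MintyMonotoneOn.segmentIntegral_add_midpoint (hd : MintyMonotoneOn d K)
    (hK : Convex ℝ K) (hx : x ∈ K) (hy : y ∈ K) :
    segmentIntegral d x (midpoint ℝ x y) + segmentIntegral d (midpoint ℝ x y) y =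
      segmentIntegral d x y := by
  have hm := hK.midpoint_mem hx hy
  rw [segmentIntegral, segmentIntegral, segmentIntegral, ← segment_trans_segment_midpoint x y,
    curveIntegral_trans (hd.curveIntegrable_segment hK hx hm)
      (hd.curveIntegrable_segment hK hm hy)]

theorem MintyMonotoneOn.le_segmentIntegral (hd : MintyMonotoneOn d K) (hK : Convex ℝ K)
    (hx : x ∈ K) (hy : y ∈ K) : inner ℝ (d x) (y - x) ≤ segmentIntegral d x y := by
  have hint := _root_.curveIntegrable_segment.1 (hd.curveIntegrable_segment hK hx hy)
  have hle : ∀ t ∈ Icc (0 : ℝ) 1,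
      inner ℝ (d x) (y - x) ≤ innerSL ℝ (d (lineMap x y t)) (y - x) := fun t ht ↦ by
    simpa using hd.monotoneOn_segment hK hx hy (left_mem_Icc.2 zero_le_one) ht ht.1
  rw [segmentIntegral, curveIntegral_segment]
  simpa using intervalIntegral.integral_mono_on zero_le_one intervalIntegrable_const hint hle

theorem MintyMonotoneOn.segmentIntegral_le (hd : MintyMonotoneOn d K) (hK : Convex ℝ K)
    (hx : x ∈ K) (hy : y ∈ K) : segmentIntegral d x y ≤ inner ℝ (d y) (y - x) := by
  have h := hd.le_segmentIntegral hK hy hx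
  rw [segmentIntegral_symm, ← neg_sub y x, inner_neg_right] at h
  linarith

theorem IsSubgradientOn.abs_segmentIntegral_sub_le {ψ : E → ℝ} (hψ : IsSubgradientOn ψ d K)
    (hK : Convex ℝ K) (k : ℕ) (hx : x ∈ K) (hy : y ∈ K) :
    |segmentIntegral d x y - (ψ y - ψ x)| ≤ 2⁻¹ ^ k * inner ℝ (d y - d x) (y - x) := by
  have hd := hψ.mintyMonotoneOn
  induction k generalizing x y with
  | zero =>
    have hlower := hd.le_segmentIntegral hK hx hy
    have hupper := hd.segmentIntegral_le hK hx hy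
    have hxy := hψ x hx y hy
    have hyx := hψ y hy x hx
    rw [← neg_sub y x, inner_neg_right] at hyx
    rw [pow_zero, one_mul, inner_sub_left, abs_le]
    constructor <;> linarith
  | succ k ih =>
    have hm : midpoint ℝ x y ∈ K := hK.midpoint_mem hx hy
    have hleft := ih hx hm
    have hright := ih hm hy
    rw [midpoint_sub_left, invOf_eq_inv, real_inner_smul_right, inner_sub_left, abs_le] at hleft
    rw [right_sub_midpoint, invOf_eq_inv, real_inner_smul_right, inner_sub_left, abs_le] at hright
    rw [← hd.segmentIntegral_add_midpoint hK hx hy, inner_sub_left, pow_succ, abs_le]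
    constructor <;> linarith [hleft.1, hleft.2, hright.1, hright.2]

theorem IsSubgradientOn.segmentIntegral_eq_sub {ψ : E → ℝ} (hψ : IsSubgradientOn ψ d K)
    (hK : Convex ℝ K) (hx : x ∈ K) (hy : y ∈ K) : segmentIntegral d x y = ψ y - ψ x := by
  have hlim : Tendsto (fun k : ℕ ↦ (2⁻¹ : ℝ) ^ k * inner ℝ (d y - d x) (y - x)) atTop (𝓝 0) := by
    simpa using (tendsto_pow_atTop_nhds_zero_of_lt_one (r := (2⁻¹ : ℝ)) (by norm_num)
      (by norm_num)).mul_const (inner ℝ (d y - d x) (y - x))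
  exact sub_eq_zero.1 <| abs_nonpos_iff.1 <|
    ge_of_tendsto' hlim fun k ↦ hψ.abs_segmentIntegral_sub_le hK k hx hy

end SegmentIntegral

section TriangleSubdivision

variable {E : Type*} [NormedAddCommGroup E] [NormedSpace ℝ E] {K : Set E}
  {p : E → E → E → Prop} {a b c : E}

theorem dist_midpoint_midpoint_left_le (a b c : E) :
    dist (midpoint ℝ a b) (midpoint ℝ a c) ≤ dist b c / 2 := by
  simpa using dist_midpoint_midpoint_le' (𝕜 := ℝ) a b a c

theorem triangle_induction_of_dist_lt {δ : ℝ} (hK : Convex ℝ K)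
    (subdivide : ∀ a ∈ K, ∀ b ∈ K, ∀ c ∈ K, p a (midpoint ℝ a b) (midpoint ℝ c a) →
      p (midpoint ℝ a b) b (midpoint ℝ b c) → p (midpoint ℝ c a) (midpoint ℝ b c) c →
      p (midpoint ℝ a b) (midpoint ℝ c a) (midpoint ℝ b c) → p a b c)
    (small : ∀ a ∈ K, ∀ b ∈ K, ∀ c ∈ K, dist a b < δ → dist b c < δ → dist c a < δ → p a b c)
    (k : ℕ) (ha : a ∈ K) (hb : b ∈ K) (hc : c ∈ K) (hab : dist a b < 2 ^ k * δ)
    (hbc : dist b c < 2 ^ k * δ) (hca : dist c a < 2 ^ k * δ) : p a b c := by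
  induction k generalizing a b c with
  | zero =>
    rw [pow_zero, one_mul] at hab hbc hca
    exact small a ha b hb c hc hab hbc hca
  | succ k ih =>
    have hab_mem := hK.midpoint_mem ha hb
    have hbc_mem := hK.midpoint_mem hb hc
    have hca_mem := hK.midpoint_mem hc ha
    have left {x y : E} (h : dist x y < 2 ^ (k + 1) * δ) :
        dist x (midpoint ℝ x y) < 2 ^ k * δ := by
      rw [pow_succ] at h
      rw [dist_left_midpoint, Real.norm_ofNat]
      linarith
    have right {x y : E} (h : dist x y < 2 ^ (k + 1) * δ) :
        dist (midpoint ℝ x y) y < 2 ^ k * δ := by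
      rw [pow_succ] at h
      rw [dist_midpoint_right, Real.norm_ofNat]
      linarith
    have across (x : E) {y z : E} (h : dist y z < 2 ^ (k + 1) * δ) :
        dist (midpoint ℝ x y) (midpoint ℝ z x) < 2 ^ k * δ := by
      rw [pow_succ] at h
      rw [midpoint_comm z x]
      linarith [dist_midpoint_midpoint_left_le x y z]
    exact subdivide a ha b hb c hc
      (ih ha hab_mem hca_mem (left hab) (across a hbc) (right hca))
      (ih hab_mem hb hbc_mem (right hab) (left hbc) (across b hca))
      (ih hca_mem hbc_mem hc (across c hab) (right hbc) (left hca))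
      (ih hab_mem hca_mem hbc_mem (across a hbc) (across c hab) (across b hca))

theorem triangle_induction (hK : Convex ℝ K)
    (subdivide : ∀ a ∈ K, ∀ b ∈ K, ∀ c ∈ K, p a (midpoint ℝ a b) (midpoint ℝ c a) →
      p (midpoint ℝ a b) b (midpoint ℝ b c) → p (midpoint ℝ c a) (midpoint ℝ b c) c →
      p (midpoint ℝ a b) (midpoint ℝ c a) (midpoint ℝ b c) → p a b c)
    (loc : ∀ x ∈ K, ∃ r > 0, ∀ a ∈ K ∩ Metric.ball x r, ∀ b ∈ K ∩ Metric.ball x r,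
      ∀ c ∈ K ∩ Metric.ball x r, p a b c)
    (ha : a ∈ K) (hb : b ∈ K) (hc : c ∈ K) : p a b c := by
  choose r hr hp using loc
  set L := convexHull ℝ {a, b, c}
  have hLK : L ⊆ K := convexHull_min (by rintro _ (rfl | rfl | rfl) <;> assumption) hK
  have hcompact : IsCompact L := (toFinite {a, b, c}).isCompact_convexHull ℝ
  obtain ⟨δ, hδ, hball⟩ := lebesgue_number_lemma_of_metric hcompact
    (c := fun x : K ↦ Metric.ball (x : E) (r x x.2)) (fun _ ↦ Metric.isOpen_ball)
    fun x hx ↦ mem_iUnion.2 ⟨⟨x, hLK hx⟩, Metric.mem_ball_self (hr _ _)⟩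
  obtain ⟨k, hk⟩ := pow_unbounded_of_one_lt ((dist a b + dist b c + dist c a) / δ) one_lt_two
  rw [div_lt_iff₀ hδ] at hk
  have hab := dist_nonneg (x := a) (y := b)
  have hbc := dist_nonneg (x := b) (y := c)
  have hca := dist_nonneg (x := c) (y := a)
  refine triangle_induction_of_dist_lt (δ := δ) (convex_convexHull ℝ {a, b, c})
    (fun a ha b hb c hc ↦ subdivide a (hLK ha) b (hLK hb) c (hLK hc))
    (fun a ha b hb c hc hab hbc hca ↦ ?_) k (subset_convexHull ℝ _ (by simp))
    (subset_convexHull ℝ _ (by simp)) (subset_convexHull ℝ _ (by simp))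
    (by linarith) (by linarith) (by linarith)
  obtain ⟨x, hx⟩ := hball a ha
  exact hp x x.2 a ⟨hLK ha, hx (Metric.mem_ball_self hδ)⟩ b ⟨hLK hb, hx (by rwa [dist_comm] at hab)⟩
    c ⟨hLK hc, hx hca⟩

end TriangleSubdivision

section Goursat

variable {E : Type*} [NormedAddCommGroup E] [InnerProductSpace ℝ E] {d : E → E} {K : Set E}
  {a b c : E}

-- Near `x`, `d` only takes values that it also takes arbitrarily close to `x`; against such a value
-- the point `x` itself may be used in the monotonicity inequality.
theorem MintyMonotoneOn.exists_ball_isSubgradientOn (hd : MintyMonotoneOn d K)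
    (hfin : (d '' K).Finite) (x : E) :
    ∃ r > 0, IsSubgradientOn (fun z ↦ inner ℝ (d z) (z - x)) d (K ∩ Metric.ball x r) := by
  have adherent : ∀ᶠ y in 𝓝 x, ∀ a ∈ d '' K, y ∈ closure (K ∩ d ⁻¹' {a}) →
      x ∈ closure (K ∩ d ⁻¹' {a}) := by
    rw [eventually_all_finite hfin]
    intro a _
    by_cases hx : x ∈ closure (K ∩ d ⁻¹' {a})
    · exact .of_forall fun _ _ ↦ hx
    · filter_upwards [isClosed_closure.isOpen_compl.mem_nhds hx] with y hy hy' using absurd hy' hy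
  obtain ⟨r, hr, hball⟩ := Metric.eventually_nhds_iff_ball.1 adherent
  refine ⟨r, hr, fun y hy z hz ↦ ?_⟩
  have hx : x ∈ closure (K ∩ d ⁻¹' {d y}) :=
    hball y hy.2 (d y) (mem_image_of_mem d hy.1) (subset_closure ⟨hy.1, rfl⟩)
  have hzx : 0 ≤ inner ℝ (d z - d y) (z - x) := by
    refine closure_minimal (fun w hw ↦ ?_)
      (isClosed_le continuous_const (by fun_prop) :
        IsClosed {w | 0 ≤ inner ℝ (d z - d y) (z - w)}) hx
    simpa only [mem_ofPred_eq, mem_singleton_iff.1 hw.2] using hd z hz.1 w hw.1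
  simp only [inner_sub_left, inner_sub_right] at hzx ⊢
  linarith

theorem MintyMonotoneOn.segmentIntegral_triangle (hd : MintyMonotoneOn d K) (hK : Convex ℝ K)
    (hfin : (d '' K).Finite) (ha : a ∈ K) (hb : b ∈ K) (hc : c ∈ K) :
    segmentIntegral d a b + segmentIntegral d b c + segmentIntegral d c a = 0 := by
  refine triangle_induction hK (p := fun a b c ↦
    segmentIntegral d a b + segmentIntegral d b c + segmentIntegral d c a = 0) ?_ ?_ ha hb hc
  · intro a ha b hb c hc h₁ h₂ h₃ h₄
    rw [← hd.segmentIntegral_add_midpoint hK ha hb, ← hd.segmentIntegral_add_midpoint hK hb hc,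
      ← hd.segmentIntegral_add_midpoint hK hc ha]
    linarith
  · intro x _
    obtain ⟨r, hr, hsub⟩ := hd.exists_ball_isSubgradientOn hfin x
    have hconv := hK.inter (convex_ball x r)
    refine ⟨r, hr, fun a ha b hb c hc ↦ ?_⟩
    rw [hsub.segmentIntegral_eq_sub hconv ha hb, hsub.segmentIntegral_eq_sub hconv hb hc,
      hsub.segmentIntegral_eq_sub hconv hc ha]
    ring

theorem MintyMonotoneOn.exists_isMaxSlopeOn (hd : MintyMonotoneOn d K) (hK : Convex ℝ K)
    (hfin : (d '' K).Finite) : ∃ c, IsMaxSlopeOn d c K := by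
  rcases K.eq_empty_or_nonempty with rfl | ⟨o, ho⟩
  · exact ⟨0, fun x hx ↦ absurd hx (notMem_empty x)⟩
  have hsub : IsSubgradientOn (segmentIntegral d o) d K := fun x hx y hy ↦ by
    have htriangle := hd.segmentIntegral_triangle hK hfin ho hx hy
    rw [segmentIntegral_symm d o y] at htriangle
    linarith [hd.le_segmentIntegral hK hx hy]
  exact hsub.exists_isMaxSlopeOn

end Goursat

section EqualLaws

variable {Ω α : Type*} [MeasurableSpace Ω] [MeasurableSpace α] {P : Measure Ω}

theorem ae_eq_of_ae_le_of_map_eq [IsFiniteMeasure P] {X Y : Ω → ℝ} (hX : AEMeasurable X P)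
    (hY : AEMeasurable Y P) (hle : X ≤ᵐ[P] Y) (hmap : P.map X = P.map Y) : X =ᵐ[P] Y := by
  have integrable_arctan {Z : Ω → ℝ} (hZ : AEMeasurable Z P) :
      Integrable (fun ω ↦ Real.arctan (Z ω)) P :=
    .of_bound (Real.continuous_arctan.measurable.comp_aemeasurable hZ).aestronglyMeasurable
      (Real.pi / 2) (.of_forall fun ω ↦ abs_le.2
        ⟨(Real.neg_pi_div_two_lt_arctan _).le, (Real.arctan_lt_pi_div_two _).le⟩)
  have integral_eq : ∫ ω, Real.arctan (X ω) ∂P = ∫ ω, Real.arctan (Y ω) ∂P := by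
    rw [← integral_map hX Real.continuous_arctan.aestronglyMeasurable, hmap,
      integral_map hY Real.continuous_arctan.aestronglyMeasurable]
  have hle' : (fun ω ↦ Real.arctan (X ω)) ≤ᵐ[P] fun ω ↦ Real.arctan (Y ω) :=
    hle.mono fun ω hω ↦ Real.arctan_strictMono.monotone hω
  have heq := (integral_eq_iff_of_ae_le (integrable_arctan hX) (integrable_arctan hY) hle').1
    integral_eq
  exact heq.mono fun ω hω ↦ Real.arctan_injective hω

variable {Q : Measure α} {F : Set α} {T : Ω → α} {a : α} {S : Set Ω}

theorem ae_measure_singleton_ne_zero (hF : F.Countable) (hQ : ∀ᵐ a ∂Q, a ∈ F) :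
    ∀ᵐ a ∂Q, Q {a} ≠ 0 := by
  have hnull : Q (⋃ a ∈ {a ∈ F | Q {a} = 0}, {a}) = 0 :=
    (measure_biUnion_null_iff (hF.mono (sep_subset _ _))).2 fun a ha ↦ ha.2
  rw [biUnion_of_singleton] at hnull
  filter_upwards [hQ, measure_eq_zero_iff_ae_notMem.1 hnull] with a haF ha h0 using ha ⟨haF, h0⟩

theorem aemeasurable_of_ae_mem_countable [MeasurableSingletonClass α] (hF : F.Countable)
    (hQ : ∀ᵐ a ∂Q, a ∈ F) (k : α → ℝ) : AEMeasurable k Q := by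
  refine ⟨F.indicator k, measurable_const.measurable_of_countable_ne (f := fun _ ↦ 0)
    (hF.mono fun a ha ↦ ?_), hQ.mono fun a ha ↦ (indicator_of_mem ha k).symm⟩
  by_contra haF
  exact ha (indicator_of_notMem haF k).symm

theorem exists_mem_eq_of_map_singleton_ne_zero [MeasurableSingletonClass α]
    (hT : AEMeasurable T P) (hS : ∀ᵐ ω ∂P, ω ∈ S) (ha : P.map T {a} ≠ 0) :
    ∃ ω ∈ S, T ω = a := by
  rw [Measure.map_apply_of_aemeasurable hT (measurableSet_singleton a),
    ← frequently_ae_mem_iff] at ha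
  obtain ⟨ω, hω, hωS⟩ := (ha.and_eventually hS).exists
  exact ⟨ω, hωS, hω⟩

end EqualLaws

section AlmostEverywhere

variable {E : Type*} [NormedAddCommGroup E] [InnerProductSpace ℝ E] [FiniteDimensional ℝ E]
  [MeasurableSpace E] [BorelSpace E] {μ P : Measure E} [μ.IsAddHaarMeasure]
  {T T' : E → E} {c c' : E → ℝ} {F S S' : Set E}

theorem ae_inner_ne {v : E} (hv : v ≠ 0) (γ : ℝ) : ∀ᵐ x ∂μ, inner ℝ v x ≠ γ := by
  let H : AffineSubspace ℝ E :=
    (AffineSubspace.mk' γ (⊥ : Submodule ℝ ℝ)).comap (innerSL ℝ v).toLinearMap.toAffineMap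
  have mem_H (x : E) : x ∈ H ↔ inner ℝ v x = γ := by simp [H, AffineSubspace.mem_mk', sub_eq_zero]
  have hH : H ≠ ⊤ := fun htop ↦ hv <| by
    have inner_eq (x : E) : inner ℝ v x = γ := (mem_H x).1 (htop ▸ AffineSubspace.mem_top ℝ E x)
    rw [← inner_self_eq_zero (𝕜 := ℝ), inner_eq v, ← inner_eq 0, inner_zero_right]
  filter_upwards [measure_eq_zero_iff_ae_notMem.1 (Measure.addHaar_affineSubspace μ H hH)]
    with x hx using fun h ↦ hx ((mem_H x).2 h)

theorem ae_injOn_inner_add (hF : F.Countable) (c : E → ℝ) :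
    ∀ᵐ x ∂μ, InjOn (fun a ↦ inner ℝ a x + c a) F := by
  have ae_ne : ∀ᵐ x ∂μ, ∀ a ∈ F, ∀ b ∈ F, a ≠ b → inner ℝ (a - b) x ≠ c b - c a :=
    (ae_ball_iff hF).2 fun a _ ↦ (ae_ball_iff hF).2 fun b _ ↦ by
      by_cases hab : a = b
      · exact .of_forall fun _ h ↦ absurd hab h
      · exact (ae_inner_ne (sub_ne_zero.2 hab) _).mono fun _ hx _ ↦ hx
  filter_upwards [ae_ne] with x hx a ha b hb hab
  by_contra hne
  refine hx a ha b hb hne ?_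
  rw [inner_sub_left]
  linarith

theorem IsMaxSlopeOn.ae_eventually_eq (hT : IsMaxSlopeOn T c S) (hfin : (T '' S).Finite) :
    ∀ᵐ x ∂μ, x ∈ S → ∀ᶠ y in 𝓝 x, y ∈ S → T y = T x := by
  filter_upwards [ae_injOn_inner_add hfin.countable c] with x hinj hx
  have strict : ∀ᶠ y in 𝓝 x, ∀ b ∈ T '' S, b ≠ T x →
      inner ℝ b y + c b < inner ℝ (T x) y + c (T x) := by
    rw [eventually_all_finite hfin]
    rintro _ ⟨z, hz, rfl⟩
    by_cases hzx : T z = T x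
    · exact .of_forall fun _ h ↦ absurd hzx h
    · have hlt : inner ℝ (T z) x + c (T z) < inner ℝ (T x) x + c (T x) :=
        (hT x hx z hz).lt_of_ne fun h ↦ hzx (hinj ⟨z, hz, rfl⟩ ⟨x, hx, rfl⟩ h)
      filter_upwards [(isOpen_lt (by fun_prop) (by fun_prop) : IsOpen
        {y | inner ℝ (T z) y + c (T z) < inner ℝ (T x) y + c (T x)}).mem_nhds hlt] with y hy _
        using hy
  filter_upwards [strict] with y hy hyS
  by_contra hne
  exact (hy (T y) ⟨y, hyS, rfl⟩ hne).not_ge (hT y hyS x hx)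

theorem IsMaxSlopeOn.ae_eventually_mem_and_eq (hT : IsMaxSlopeOn T c S) (hfin : (T '' S).Finite)
    (hS : Convex ℝ S) : ∀ᵐ x ∂μ, x ∈ S → ∀ᶠ y in 𝓝 x, y ∈ S ∧ T y = T x := by
  filter_upwards [hT.ae_eventually_eq hfin, measure_eq_zero_iff_ae_notMem.1 (hS.addHaar_frontier μ)]
    with x hconst hfr hx
  have hxS : S ∈ 𝓝 x := mem_interior_iff_mem_nhds.1 <| by
    by_contra h
    exact hfr ⟨subset_closure hx, h⟩
  filter_upwards [hconst hx, hxS] with y hy hyS using ⟨hyS, hy hyS⟩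

theorem IsMaxSlopeOn.exists_convexOn_hasFDerivAt (hT : IsMaxSlopeOn T c S)
    (hfin : (T '' S).Finite) :
    ∃ φ : E → ℝ, ConvexOn ℝ univ φ ∧ ∀ᵐ x ∂μ, x ∈ S → HasFDerivAt φ (innerSL ℝ (T x)) x := by
  rcases S.eq_empty_or_nonempty with rfl | hne
  · exact ⟨0, convexOn_const 0 convex_univ, .of_forall fun x hx ↦ absurd hx (notMem_empty x)⟩
  obtain ⟨m, hmS, hmax, hm⟩ := exists_isMaxSlopeOn_univ hfin (hne.image T) c
  refine ⟨fun x ↦ inner ℝ (m x) x + c (m x), hm.isSubgradientOn.convexOn convex_univ, ?_⟩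
  have hmfin : (m '' univ).Finite := hfin.subset (image_subset_iff.2 fun x _ ↦ hmS x)
  filter_upwards [hm.ae_eventually_eq hmfin, ae_injOn_inner_add hfin.countable c]
    with x hconst hinj hxS
  have hTx : m x = T x := by
    refine hinj (hmS x) (mem_image_of_mem T hxS) (le_antisymm ?_ (hmax x _ ⟨x, hxS, rfl⟩))
    obtain ⟨y, hy, hyx⟩ := hmS x
    exact hyx ▸ hT x hxS y hy
  have haffine : HasFDerivAt (fun y ↦ inner ℝ (T x) y + c (T x)) (innerSL ℝ (T x)) x :=
    (innerSL ℝ (T x)).hasFDerivAt.add_const _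
  refine haffine.congr_of_eventuallyEq ?_
  filter_upwards [hconst trivial] with y hy
  rw [hy trivial, hTx]

theorem IsMaxSlopeOn.ae_le_of_map_eq (hT : IsMaxSlopeOn T c S) (hS : ∀ᵐ x ∂P, x ∈ S)
    (hTm : AEMeasurable T P) (hTm' : AEMeasurable T' P) (hmap : P.map T' = P.map T)
    (hF : F.Countable) (hTF : ∀ᵐ a ∂P.map T, a ∈ F) :
    ∀ᵐ x ∂P, inner ℝ (T' x) x + c (T' x) ≤ inner ℝ (T x) x + c (T x) := by
  have hatom := ae_measure_singleton_ne_zero hF hTF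
  rw [← hmap] at hatom
  filter_upwards [hS, ae_of_ae_map hTm' hatom] with x hx hTx
  rw [hmap] at hTx
  obtain ⟨y, hy, hyx⟩ := exists_mem_eq_of_map_singleton_ne_zero hTm hS hTx
  exact hyx ▸ hT x hx y hy

theorem IsMaxSlopeOn.ae_eq [IsFiniteMeasure P] (hP : P ≪ μ) (hT : IsMaxSlopeOn T c S)
    (hT' : IsMaxSlopeOn T' c' S') (hS : ∀ᵐ x ∂P, x ∈ S) (hS' : ∀ᵐ x ∂P, x ∈ S')
    (hTm : AEMeasurable T P) (hTm' : AEMeasurable T' P) (hmap : P.map T = P.map T')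
    (hF : F.Countable) (hTF : ∀ᵐ x ∂P, T x ∈ F) : T =ᵐ[P] T' := by
  have hQF : ∀ᵐ a ∂P.map T, a ∈ F := (ae_map_iff hTm hF.measurableSet).2 hTF
  have slack := hT.ae_le_of_map_eq hS hTm hTm' hmap.symm hF hQF
  have slack' := hT'.ae_le_of_map_eq hS' hTm' hTm hmap hF (hmap ▸ hQF)
  have hTF' : ∀ᵐ x ∂P, T' x ∈ F := ae_of_ae_map hTm' (hmap ▸ hQF)
  -- The two slacks bound `c ∘ T - c' ∘ T` from below by `c ∘ T' - c' ∘ T'`, a function with the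
  -- same law, so both are equalities.
  let gap (a : E) : ℝ := c a - c' a
  have gap_meas : AEMeasurable gap (P.map T) := aemeasurable_of_ae_mem_countable hF hQF gap
  have gap_meas' : AEMeasurable gap (P.map T') := hmap ▸ gap_meas
  have gap_le : gap ∘ T' ≤ᵐ[P] gap ∘ T := by
    filter_upwards [slack, slack'] with x h h'
    simp only [gap, Function.comp_apply]
    linarith
  have gap_eq := ae_eq_of_ae_le_of_map_eq (gap_meas'.comp_aemeasurable hTm')
    (gap_meas.comp_aemeasurable hTm) gap_le (by
      rw [← AEMeasurable.map_map_of_aemeasurable gap_meas' hTm',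
        ← AEMeasurable.map_map_of_aemeasurable gap_meas hTm, hmap])
  filter_upwards [slack, slack', gap_eq, hP.ae_le (ae_injOn_inner_add hF c), hTF, hTF']
    with x h h' heq hinj hx hx'
  simp only [gap, Function.comp_apply] at heq
  exact hinj hx hx' (by linarith)

end AlmostEverywhere

section Gradient

variable {E : Type*} [NormedAddCommGroup E] [NormedSpace ℝ E] {C D W : Set E} {φ : E → ℝ}
  {φ' : E →L[ℝ] ℝ} {x y : E}

theorem add_fderiv_sub_le_of_convexOn (hφ : ConvexOn ℝ C φ) (hx : x ∈ C) (hy : y ∈ C)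
    (hφ' : HasFDerivAt φ φ' x) : φ x + φ' (y - x) ≤ φ y := by
  have hconv : ConvexOn ℝ (Icc (0 : ℝ) 1) (φ ∘ (lineMap x y : ℝ →ᵃ[ℝ] E)) :=
    (hφ.comp_affineMap (lineMap x y)).subset (fun t ht ↦ hφ.1.lineMap_mem hx hy ht)
      (convex_Icc 0 1)
  have hder : HasDerivAt (φ ∘ (lineMap x y : ℝ →ᵃ[ℝ] E)) (φ' (y - x)) 0 :=
    HasFDerivAt.comp_hasDerivAt 0 (by rwa [lineMap_apply_zero]) hasDerivAt_lineMap
  have hslope := hconv.le_slope_of_hasDerivAt (x := 0) (y := 1) (by simp) (by simp) one_pos hder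
  simp only [slope_def_field, Function.comp_apply, lineMap_apply_one, lineMap_apply_zero, sub_zero,
    div_one] at hslope
  linarith

theorem hasFDerivAt_of_convexOn_of_dense [FiniteDimensional ℝ E] (hφ : ConvexOn ℝ C φ)
    (hW : IsOpen W) (hDW : D ⊆ W) (hWD : W ⊆ closure D)
    (hD : ∀ y ∈ D, y ∈ interior C ∧ HasFDerivAt φ φ' y) (hx : x ∈ W) : HasFDerivAt φ φ' x := by
  have hDC : D ⊆ interior C := fun y hy ↦ (hD y hy).1
  obtain ⟨y₀, hy₀⟩ : D.Nonempty := closure_nonempty_iff.1 ⟨x, hWD hx⟩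
  have hWC : W ⊆ interior C := by
    rw [← hφ.1.interior_closure_eq_interior_of_nonempty_interior ⟨y₀, hDC hy₀⟩]
    exact interior_maximal (hWD.trans (closure_mono (hDC.trans interior_subset))) hW
  have affine_on_D : EqOn φ (fun y ↦ φ' y + (φ y₀ - φ' y₀)) D := by
    intro y hy
    have h := add_fderiv_sub_le_of_convexOn hφ (interior_subset (hDC hy))
      (interior_subset (hDC hy₀)) (hD y hy).2
    have h₀ := add_fderiv_sub_le_of_convexOn hφ (interior_subset (hDC hy₀))
      (interior_subset (hDC hy)) (hD y₀ hy₀).2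
    simp only [map_sub] at h h₀ ⊢
    linarith
  have affine_on_W : EqOn φ (fun y ↦ φ' y + (φ y₀ - φ' y₀)) W :=
    affine_on_D.of_subset_closure (hφ.continuousOn_interior.mono hWC) (by fun_prop) hDW hWD
  exact (φ'.hasFDerivAt.add_const _).congr_of_eventuallyEq
    (affine_on_W.eventuallyEq_of_mem (hW.mem_nhds hx))

end Gradient

section Support

variable {X : Type*} [TopologicalSpace X] [MeasurableSpace X]

theorem support_subset_closure_of_ae_mem {P : Measure X} {D : Set X} (hD : ∀ᵐ x ∂P, x ∈ D) :
    P.support ⊆ closure D :=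
  Measure.support_subset_of_isClosed isClosed_closure (mem_of_superset hD subset_closure)

theorem support_map_subset_closure_image [OpensMeasurableSpace X] {Ω : Type*} [MeasurableSpace Ω]
    {ν : Measure Ω} {h : Ω → X} (hh : AEMeasurable h ν) {s : Set Ω} (hs : ∀ᵐ ω ∂ν, ω ∈ s) :
    (ν.map h).support ⊆ closure (h '' s) := by
  have hclosure : ∀ᵐ x ∂ν.map h, x ∈ closure (h '' s) :=
    (ae_map_iff hh isClosed_closure.measurableSet).2 <|
      hs.mono fun _ hω ↦ subset_closure (mem_image_of_mem h hω)
  simpa only [closure_closure] using support_subset_closure_of_ae_mem hclosure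

end Support

section Brenier

variable {n : ℕ} {P Q : Measure (Rn n)} {T T' : Rn n → Rn n} {c φ : Rn n → ℝ}
  {C F K S : Set (Rn n)}

theorem measurable_gradient (φ : Rn n → ℝ) : Measurable (∇ φ) :=
  (InnerProductSpace.toDual ℝ (Rn n)).symm.continuous.measurable.comp (measurable_fderiv ℝ φ)

theorem IsMaxSlopeOn.isGradientTransport (hP : P ≪ volume) (hT : IsMaxSlopeOn T c S)
    (hfin : (T '' S).Finite) (hS : ∀ᵐ x ∂P, x ∈ S) : IsGradientTransport P (P.map T) T := by
  obtain ⟨φ, hφ, hTφ⟩ := hT.exists_convexOn_hasFDerivAt (μ := volume) hfin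
  have hgrad : ∀ᵐ x ∂P, HasGradientAt φ (T x) x := by
    filter_upwards [hP.ae_le hTφ, hS] with x hx hxS using hasGradientAt_iff_hasFDerivAt.2 (hx hxS)
  have hT_eq : T =ᵐ[P] ∇ φ := hgrad.mono fun x hx ↦ hx.gradient.symm
  exact ⟨univ, φ, ⟨hφ, hgrad.mono fun x hx ↦ ⟨by simp, hx.differentiableAt⟩,
    (measurable_gradient φ).aemeasurable, Measure.map_congr hT_eq.symm⟩, hT_eq⟩

theorem IsGradientTransport.aemeasurable (hT : IsGradientTransport P Q T) : AEMeasurable T P := by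
  obtain ⟨C, φ, ⟨-, -, hφ, -⟩, hTφ⟩ := hT
  exact hφ.congr hTφ.symm

theorem IsBrenierPotential.isSubgradientOn (hφ : IsBrenierPotential P Q C φ) :
    IsSubgradientOn φ (∇ φ) {x | x ∈ interior C ∧ DifferentiableAt ℝ φ x} := by
  intro x hx y hy
  exact add_fderiv_sub_le_of_convexOn hφ.1 (interior_subset hx.1) (interior_subset hy.1)
    hx.2.hasGradientAt.hasFDerivAt

theorem IsMonotoneTransportOn.exists_isMaxSlopeOn (hT : IsMonotoneTransportOn P Q K F T)
    (hK : Convex ℝ K) (hF : F.Finite) : ∃ c, IsMaxSlopeOn T c K :=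
  hT.2.1.mintyMonotoneOn.exists_isMaxSlopeOn hK (hF.subset hT.1.image_subset)

theorem IsMonotoneTransportOn.ae_eq [IsFiniteMeasure P] (hP : P ≪ volume) (hK : Convex ℝ K)
    (hPK : ∀ᵐ x ∂P, x ∈ K) (hF : F.Finite) (hT : IsMonotoneTransportOn P Q K F T)
    (hT' : IsMonotoneTransportOn P Q K F T') : T =ᵐ[P] T' := by
  obtain ⟨c, hc⟩ := hT.exists_isMaxSlopeOn hK hF
  obtain ⟨c', hc'⟩ := hT'.exists_isMaxSlopeOn hK hF
  exact hc.ae_eq hP hc' hPK hPK hT.2.2.1 hT'.2.2.1 (hT.2.2.2.trans hT'.2.2.2.symm) hF.countable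
    (hPK.mono hT.1)

theorem IsMonotoneTransportOn.isBrenierMap [IsFiniteMeasure P] (hP : P ≪ volume)
    (hK : Convex ℝ K) (hPK : ∀ᵐ x ∂P, x ∈ K) (hF : F.Finite)
    (hT : IsMonotoneTransportOn P Q K F T) : IsBrenierMap P Q T := by
  obtain ⟨c, hc⟩ := hT.exists_isMaxSlopeOn hK hF
  refine ⟨hT.2.2.2 ▸ hc.isGradientTransport hP (hF.subset hT.1.image_subset) hPK, ?_⟩
  rintro U ⟨C, φ, hφ, hU⟩
  obtain ⟨c', hc'⟩ := hφ.isSubgradientOn.exists_isMaxSlopeOn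
  exact hU.trans (hc.ae_eq hP hc' hPK hφ.2.1 hT.2.2.1 hφ.2.2.1
    (hT.2.2.2.trans hφ.2.2.2.symm) hF.countable (hPK.mono hT.1)).symm

theorem IsMonotoneTransportOn.ae_gradient_eq [IsFiniteMeasure P] (hP : P ≪ volume)
    (hK : Convex ℝ K) (hPK : IsSupportedOn P K) (hF : F.Finite)
    (hT : IsMonotoneTransportOn P Q K F T) (hφ : IsBrenierPotential P Q C φ) :
    ∀ᵐ x, x ∈ K → ∇ φ x = T x := by
  obtain ⟨c, hc⟩ := hT.exists_isMaxSlopeOn hK hF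
  have hφT : ∇ φ =ᵐ[P] T :=
    (hT.isBrenierMap hP hK (mem_ae_iff.2 hPK.1) hF).2 _ ⟨C, φ, hφ, .rfl⟩
  have dense : P.support ⊆ closure {y | y ∈ interior C ∧ HasGradientAt φ (T y) y} := by
    refine support_subset_closure_of_ae_mem ?_
    filter_upwards [hφ.2.1, hφT] with y hy hyT using ⟨hy.1, hyT ▸ hy.2.hasGradientAt⟩
  filter_upwards [hc.ae_eventually_mem_and_eq (hF.subset hT.1.image_subset) hK] with x hx hxK
  obtain ⟨W, hWT, hW, hxW⟩ := eventually_nhds_iff.1 (hx hxK)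
  have hWP : W ⊆ P.support := fun y hy ↦ hPK.2 (hWT y hy).1
  refine (hasGradientAt_iff_hasFDerivAt.2 ?_ : HasGradientAt φ (T x) x).gradient
  refine hasFDerivAt_of_convexOn_of_dense hφ.1 hW inter_subset_left
    ((subset_inter subset_rfl (hWP.trans dense)).trans hW.inter_closure) ?_ hxW
  rintro y ⟨hyW, hyC, hy⟩
  exact ⟨hyC, (hWT y hyW).2 ▸ hy.hasFDerivAt⟩

end Brenier

section Tails

variable {X : Type*} [MeasurableSpace X] {P : Measure X} [IsProbabilityMeasure P] {g : X → ℝ}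

theorem exists_measureReal_lt_lt (hg : Measurable g) {ε : ℝ} (hε : 0 < ε) :
    ∃ N, 0 ≤ N ∧ P.real {x | N < g x} < ε := by
  have := Measure.isProbabilityMeasure_map (μ := P) hg.aemeasurable
  obtain ⟨N, hN, hN0⟩ := (((ProbabilityTheory.tendsto_cdf_atTop (P.map g)).eventually_const_lt
    (sub_lt_self (1 : ℝ) hε)).and (eventually_ge_atTop (0 : ℝ))).exists
  rw [ProbabilityTheory.cdf_eq_real, map_measureReal_apply hg measurableSet_Iic] at hN
  have hcompl : {x | N < g x} = (g ⁻¹' Iic N)ᶜ :=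
    Set.ext fun x ↦ (not_le (a := g x)).symm
  refine ⟨N, hN0, ?_⟩
  rw [hcompl, probReal_compl_eq_one_sub (hg measurableSet_Iic)]
  linarith

theorem le_measureReal_nonpos {r : ℝ} (hg : Measurable g)
    (h : ∀ ε > 0, r ≤ P.real {x | g x ≤ ε}) : r ≤ P.real {x | g x ≤ 0} := by
  have := Measure.isProbabilityMeasure_map (μ := P) hg.aemeasurable
  have hcdf : ∀ t, ProbabilityTheory.cdf (P.map g) t = P.real {x | g x ≤ t} := fun t ↦ by
    rw [ProbabilityTheory.cdf_eq_real, map_measureReal_apply hg measurableSet_Iic]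
    rfl
  rw [← hcdf]
  refine ge_of_tendsto (((ProbabilityTheory.cdf (P.map g)).right_continuous 0).mono_left
    (nhdsWithin_mono _ Ioi_subset_Ici_self)) (eventually_mem_nhdsWithin.mono fun ε hε ↦ ?_)
  exact (h ε hε).trans (hcdf ε).ge

end Tails

section PriceEnvelope

variable {X ι : Type*} [Finite ι] {f : ι → X → ℝ} {c c' : ι → ℝ} {x : X} {r : ℝ}

/-- The upper envelope of the scores `f i`, raised by the prices `c i`. -/
noncomputable def priceEnvelope (f : ι → X → ℝ) (c : ι → ℝ) (x : X) : ℝ :=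
  ⨆ i, f i x + c i

theorem add_le_priceEnvelope (f : ι → X → ℝ) (c : ι → ℝ) (x : X) (i : ι) :
    f i x + c i ≤ priceEnvelope f c x :=
  le_ciSup (finite_range fun i ↦ f i x + c i).bddAbove i

theorem measurable_priceEnvelope [MeasurableSpace X] (hf : ∀ i, Measurable (f i)) (c : ι → ℝ) :
    Measurable (priceEnvelope f c) :=
  .iSup fun i ↦ (hf i).add_const _

variable [Nonempty ι]

theorem priceEnvelope_le_iff : priceEnvelope f c x ≤ r ↔ ∀ i, f i x + c i ≤ r :=
  ciSup_le_iff (finite_range _).bddAbove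

theorem priceEnvelope_le_add (h : ∀ i, c i ≤ c' i + r) :
    priceEnvelope f c x ≤ priceEnvelope f c' x + r :=
  priceEnvelope_le_iff.2 fun i ↦ by linarith [h i, add_le_priceEnvelope f c' x i]

theorem priceEnvelope_sub_const (c : ι → ℝ) (r : ℝ) :
    priceEnvelope f (fun i ↦ c i - r) x = priceEnvelope f c x - r :=
  le_antisymm (priceEnvelope_le_add (r := -r) fun _ ↦ le_rfl)
    (sub_le_iff_le_add.2 (priceEnvelope_le_add fun i ↦ (sub_add_cancel (c i) r).ge))

theorem abs_priceEnvelope_sub_le (h : ∀ i, |c i - c' i| ≤ r) :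
    |priceEnvelope f c x - priceEnvelope f c' x| ≤ r :=
  abs_sub_le_iff.2
    ⟨sub_le_iff_le_add'.2 (priceEnvelope_le_add fun i ↦
      sub_le_iff_le_add'.1 (abs_sub_le_iff.1 (h i)).1),
    sub_le_iff_le_add'.2 (priceEnvelope_le_add fun i ↦
      sub_le_iff_le_add'.1 (abs_sub_le_iff.1 (h i)).2)⟩

theorem integrable_priceEnvelope_sub [MeasurableSpace X] {P : Measure X} [IsFiniteMeasure P]
    (hf : ∀ i, Measurable (f i)) (c c' : ι → ℝ) :
    Integrable (fun x ↦ priceEnvelope f c x - priceEnvelope f c' x) P := by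
  cases nonempty_fintype ι
  exact .of_bound ((measurable_priceEnvelope hf c).sub
    (measurable_priceEnvelope hf c')).aestronglyMeasurable ‖c - c'‖
    (.of_forall fun _ ↦ abs_priceEnvelope_sub_le (norm_le_pi_norm (c - c')))

theorem priceEnvelope_add_single_sub_le [DecidableEq ι] (c : ι → ℝ) (i : ι) {ε : ℝ} (hε : 0 ≤ ε) :
    priceEnvelope f (c + Pi.single i ε) x - priceEnvelope f c x ≤
      {x | priceEnvelope f c x - (f i x + c i) ≤ ε}.indicator (fun _ ↦ ε) x := by
  by_cases hx : priceEnvelope f c x - (f i x + c i) ≤ ε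
  · rw [indicator_of_mem (mem_ofPred_eq ▸ hx), sub_le_iff_le_add']
    refine priceEnvelope_le_add fun j ↦ ?_
    obtain rfl | hj := eq_or_ne j i
    · simp
    · simpa [Pi.single_eq_of_ne hj] using hε
  · rw [indicator_of_notMem (mem_ofPred_eq ▸ hx), sub_nonpos]
    refine priceEnvelope_le_iff.2 fun j ↦ ?_
    obtain rfl | hj := eq_or_ne j i
    · rw [Pi.add_apply, Pi.single_eq_same]
      linarith [not_le.1 hx]
    · simpa [Pi.single_eq_of_ne hj] using add_le_priceEnvelope f c x j

end PriceEnvelope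

section SemidiscreteDual

variable {X ι : Type*} [MeasurableSpace X] {P : Measure X} [Fintype ι] {f : ι → X → ℝ}
  {c q : ι → ℝ}

theorem mul_norm_le_neg_sum {κ : ℝ} (hκ : 0 ≤ κ) (hq : ∀ i, κ ≤ q i) (hc : c ≤ 0) :
    κ * ‖c‖ ≤ -∑ i, q i * c i := by
  have hnorm : ‖c‖ ≤ ∑ i, -c i :=
    (pi_norm_le_iff_of_nonneg (Finset.sum_nonneg fun i _ ↦ neg_nonneg.2 (hc i))).2 fun i ↦ by
      rw [Real.norm_of_nonpos (hc i)]
      exact Finset.single_le_sum (fun j _ ↦ neg_nonneg.2 (hc j)) (Finset.mem_univ i)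
  calc κ * ‖c‖ ≤ ∑ i, κ * -c i := by
        rw [← Finset.mul_sum]
        exact mul_le_mul_of_nonneg_left hnorm hκ
    _ ≤ ∑ i, q i * -c i :=
        Finset.sum_le_sum fun i _ ↦ mul_le_mul_of_nonneg_right (hq i) (neg_nonneg.2 (hc i))
    _ = -∑ i, q i * c i := by simp only [mul_neg, Finset.sum_neg_distrib]

/-- The dual functional of the semidiscrete transport problem that assigns the points of `(X, P)` to
alternatives `i` with scores `f i` and target masses `q i`. Subtracting the envelope at price `0`
makes it finite without any integrability assumption on the scores. -/
noncomputable def semidiscreteDual (P : Measure X) (f : ι → X → ℝ) (q c : ι → ℝ) : ℝ :=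
  ∫ x, (priceEnvelope f c x - priceEnvelope f 0 x) ∂P - ∑ i, q i * c i

theorem semidiscreteDual_zero (P : Measure X) (f : ι → X → ℝ) (q : ι → ℝ) :
    semidiscreteDual P f q 0 = 0 := by
  simp [semidiscreteDual]

variable [Nonempty ι]

theorem semidiscreteDual_sub [IsFiniteMeasure P] (hf : ∀ i, Measurable (f i)) (q c c' : ι → ℝ) :
    semidiscreteDual P f q c - semidiscreteDual P f q c' =
      ∫ x, (priceEnvelope f c x - priceEnvelope f c' x) ∂P - ∑ i, q i * (c i - c' i) := by
  have hint : ∫ x, (priceEnvelope f c x - priceEnvelope f c' x) ∂P =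
      ∫ x, (priceEnvelope f c x - priceEnvelope f 0 x) ∂P -
        ∫ x, (priceEnvelope f c' x - priceEnvelope f 0 x) ∂P := by
    rw [← integral_sub (integrable_priceEnvelope_sub hf c 0)
      (integrable_priceEnvelope_sub hf c' 0)]
    simp only [sub_sub_sub_cancel_right]
  simp only [semidiscreteDual, hint, mul_sub, Finset.sum_sub_distrib]
  ring

variable [IsProbabilityMeasure P]

theorem continuous_semidiscreteDual (hf : ∀ i, Measurable (f i)) (q : ι → ℝ) :
    Continuous (semidiscreteDual P f q) := by
  refine Continuous.sub ?_ (by fun_prop)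
  refine (LipschitzWith.of_dist_le_mul (K := 1) fun c c' ↦ ?_).continuous
  have hbound : ‖∫ x, (priceEnvelope f c x - priceEnvelope f c' x) ∂P‖ ≤ ‖c - c'‖ * P.real univ :=
    norm_integral_le_of_norm_le_const (.of_forall fun _ ↦
      abs_priceEnvelope_sub_le (norm_le_pi_norm (c - c')))
  rw [dist_eq_norm, dist_eq_norm, ← integral_sub (integrable_priceEnvelope_sub hf c 0)
    (integrable_priceEnvelope_sub hf c' 0)]
  simpa using hbound

theorem semidiscreteDual_sub_const (hf : ∀ i, Measurable (f i)) (hq : ∑ i, q i = 1) (c : ι → ℝ)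
    (r : ℝ) : semidiscreteDual P f q (fun i ↦ c i - r) = semidiscreteDual P f q c := by
  rw [← sub_eq_zero, semidiscreteDual_sub hf]
  simp [priceEnvelope_sub_const, ← Finset.sum_mul, hq]

-- Where every score is within `N` of the best one, the alternative with zero price bounds the drop
-- of the envelope by `N`; elsewhere the drop is at most `‖c‖`.
theorem neg_le_integral_priceEnvelope_sub (hf : ∀ i, Measurable (f i)) (hc : ∃ i, c i = 0) {N : ℝ}
    (hN : 0 ≤ N) :
    -N - P.real {x | N < ⨆ i, (priceEnvelope f 0 x - f i x)} * ‖c‖ ≤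
      ∫ x, (priceEnvelope f c x - priceEnvelope f 0 x) ∂P := by
  obtain ⟨i, hi⟩ := hc
  set B : Set X := {x | N < ⨆ i, (priceEnvelope f 0 x - f i x)}
  have hBm : MeasurableSet B := measurableSet_lt measurable_const
    (.iSup fun i ↦ (measurable_priceEnvelope hf 0).sub (hf i))
  have hpt : ∀ x, -N + B.indicator (fun _ ↦ -‖c‖) x ≤
      priceEnvelope f c x - priceEnvelope f 0 x := by
    intro x
    by_cases hx : x ∈ B
    · have hnorm := abs_le.1 (abs_priceEnvelope_sub_le (f := f) (c' := 0) (x := x)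
        fun i ↦ (norm_le_pi_norm (c - 0) i))
      rw [sub_zero] at hnorm
      rw [indicator_of_mem hx]
      linarith
    · have hdef : priceEnvelope f 0 x - f i x ≤ N :=
        (le_ciSup (finite_range fun i ↦ priceEnvelope f 0 x - f i x).bddAbove i).trans
          (not_lt.1 hx)
      rw [indicator_of_notMem hx]
      linarith [add_le_priceEnvelope f c x i]
  have hiB : Integrable (B.indicator fun _ ↦ -‖c‖) P := (integrable_const _).indicator hBm
  calc -N - P.real B * ‖c‖ = ∫ x, (-N + B.indicator (fun _ ↦ -‖c‖) x) ∂P := by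
        rw [integral_add (integrable_const _) hiB, integral_indicator hBm]
        simp [sub_eq_add_neg]
    _ ≤ _ := integral_mono ((integrable_const _).add hiB) (integrable_priceEnvelope_sub hf c 0) hpt

theorem exists_mul_norm_sub_le_semidiscreteDual (hf : ∀ i, Measurable (f i))
    (hq : ∀ i, 0 < q i) : ∃ κ > 0, ∃ N, ∀ c ≤ 0, (∃ i, c i = 0) →
      κ * ‖c‖ - N ≤ semidiscreteDual P f q c := by
  obtain ⟨j, hj⟩ := Finite.exists_min q
  obtain ⟨N, hN, hP⟩ := exists_measureReal_lt_lt (P := P)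
    (g := fun x ↦ ⨆ i, (priceEnvelope f 0 x - f i x))
    (.iSup fun i ↦ (measurable_priceEnvelope hf 0).sub (hf i)) (half_pos (hq j))
  refine ⟨q j / 2, half_pos (hq j), N, fun c hc hi ↦ ?_⟩
  have hsum := mul_norm_le_neg_sum (hq j).le hj hc
  have hint := neg_le_integral_priceEnvelope_sub (P := P) hf hi hN
  have htail := mul_le_mul_of_nonneg_right hP.le (norm_nonneg c)
  rw [semidiscreteDual]
  linarith

theorem exists_forall_semidiscreteDual_le (hf : ∀ i, Measurable (f i)) (hq : ∀ i, 0 < q i)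
    (hq1 : ∑ i, q i = 1) : ∃ c, ∀ c', semidiscreteDual P f q c ≤ semidiscreteDual P f q c' := by
  set S : Set (ι → ℝ) := {c | c ≤ 0 ∧ ∃ i, c i = 0} with hS
  have hSc : IsClosed S := by
    have hzero : IsClosed (⋃ i, {c : ι → ℝ | c i = 0}) :=
      isClosed_iUnion_of_finite fun i ↦ isClosed_eq (continuous_apply i) continuous_const
    simpa only [hS, ofPred_and, iUnion_ofPred] using
      (isClosed_le continuous_id' continuous_const).inter hzero
  obtain ⟨κ, hκ, N, hcoercive⟩ := exists_mul_norm_sub_le_semidiscreteDual (P := P) hf hq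
  obtain ⟨c, -, hc⟩ := (continuous_semidiscreteDual hf q).continuousOn.exists_isMinOn' hSc
    (x₀ := 0) ⟨le_rfl, Classical.arbitrary ι, rfl⟩ (eventually_inf_principal.2 <|
      (tendsto_norm_cocompact_atTop.eventually_ge_atTop (N / κ)).mono fun c hc hcS ↦ by
        rw [div_le_iff₀' hκ] at hc
        rw [semidiscreteDual_zero]
        linarith [hcoercive c hcS.1 hcS.2])
  refine ⟨c, fun c' ↦ ?_⟩
  obtain ⟨l, hl⟩ := Finite.exists_max c'
  rw [← semidiscreteDual_sub_const hf hq1 c' (c' l)]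
  exact hc ⟨fun i ↦ sub_nonpos.2 (hl i), l, sub_self _⟩

-- First-order optimality of `c`: raising the price `c i` by `ε` only affects the points at which
-- alternative `i` is within `ε` of being the best one.
theorem le_measureReal_priceEnvelope_sub_le (hf : ∀ i, Measurable (f i))
    (hc : ∀ c', semidiscreteDual P f q c ≤ semidiscreteDual P f q c') (i : ι) {ε : ℝ} (hε : 0 < ε) :
    q i ≤ P.real {x | priceEnvelope f c x - (f i x + c i) ≤ ε} := by
  classical
  set A : Set X := {x | priceEnvelope f c x - (f i x + c i) ≤ ε}
  have hAm : MeasurableSet A := measurableSet_le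
    ((measurable_priceEnvelope hf c).sub ((hf i).add_const _)) measurable_const
  have hint := integral_mono (integrable_priceEnvelope_sub (P := P) hf (c + Pi.single i ε) c)
    ((integrable_const ε).indicator hAm) fun _ ↦ priceEnvelope_add_single_sub_le c i hε.le
  rw [integral_indicator hAm, setIntegral_const, smul_eq_mul] at hint
  have hdual := semidiscreteDual_sub (P := P) hf q (c + Pi.single i ε) c
  have hsum : ∑ j, q j * ((c + Pi.single i ε : ι → ℝ) j - c j) = q i * ε := by
    simp [Pi.single_apply]
  have hmul : q i * ε ≤ P.real A * ε := by linarith [hc (c + Pi.single i ε)]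
  exact le_of_mul_le_mul_right hmul hε

theorem exists_forall_le_measureReal_cell (hf : ∀ i, Measurable (f i)) (hq : ∀ i, 0 < q i)
    (hq1 : ∑ i, q i = 1) :
    ∃ c : ι → ℝ, ∀ i, q i ≤ P.real {x | ∀ j, f j x + c j ≤ f i x + c i} := by
  obtain ⟨c, hc⟩ := exists_forall_semidiscreteDual_le (P := P) hf hq hq1
  refine ⟨c, fun i ↦ ?_⟩
  have hcell := le_measureReal_nonpos
    ((measurable_priceEnvelope hf c).sub ((hf i).add_const (c i)))
    fun ε hε ↦ le_measureReal_priceEnvelope_sub_le (P := P) hf hc i hε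
  simpa only [Pi.sub_apply, sub_nonpos, priceEnvelope_le_iff] using hcell

end SemidiscreteDual

section SemidiscreteTransport

theorem eq_of_forall_measure_singleton_le {α : Type*} [MeasurableSpace α]
    [MeasurableSingletonClass α] {P Q : Measure α} [IsProbabilityMeasure P]
    [IsProbabilityMeasure Q] {A : Set α} (hA : A.Countable) (hQ : ∀ᵐ a ∂Q, a ∈ A)
    (h : ∀ a ∈ A, Q {a} ≤ P {a}) : Q = P := by
  refine Measure.eq_of_le_of_isProbabilityMeasure (Measure.le_iff.2 fun s _ ↦ ?_)
  have hfiber (R : Measure α) : ∑' a : ↥(s ∩ A), R {(a : α)} = R (s ∩ A) :=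
    tsum_measure_preimage_singleton (hA.mono inter_subset_right) (f := id)
      fun a _ ↦ measurableSet_singleton a
  calc Q s ≤ Q (s ∩ A) := measure_mono_ae (hQ.mono fun a ha has ↦ ⟨has, ha⟩)
    _ = ∑' a : ↥(s ∩ A), Q {(a : α)} := (hfiber Q).symm
    _ ≤ ∑' a : ↥(s ∩ A), P {(a : α)} := ENNReal.tsum_le_tsum fun a ↦ h a a.2.2
    _ = P (s ∩ A) := hfiber P
    _ ≤ P s := measure_mono inter_subset_left

theorem exists_forall_measure_singleton_le_measure_cell {E : Type*} [NormedAddCommGroup E]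
    [InnerProductSpace ℝ E] [MeasurableSpace E] [BorelSpace E] (P : Measure E) {Q : Measure E}
    [IsProbabilityMeasure P] [IsProbabilityMeasure Q] {A : Finset E} (hA : ∀ a ∈ A, Q {a} ≠ 0)
    (hQ : ∀ᵐ a ∂Q, a ∈ A) :
    ∃ c : E → ℝ, ∀ a ∈ A, Q {a} ≤ P {x | ∀ b ∈ A, inner ℝ b x + c b ≤ inner ℝ a x + c a} := by
  have hne : Nonempty A := hQ.exists.elim fun a ha ↦ ⟨a, ha⟩
  have hsum : ∑ a : A, Q.real {(a : E)} = 1 := by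
    rw [Finset.sum_coe_sort A fun a ↦ Q.real {a}, sum_measureReal_singleton, measureReal_def,
      (prob_compl_eq_zero_iff A.measurableSet).1 hQ, ENNReal.toReal_one]
  obtain ⟨c, hc⟩ := exists_forall_le_measureReal_cell (P := P)
    (f := fun (a : A) x ↦ inner ℝ (a : E) x) (fun a ↦ by fun_prop)
    (fun a ↦ ENNReal.toReal_pos (hA a a.2) (measure_ne_top Q _)) hsum
  refine ⟨Function.extend Subtype.val c 0, fun a ha ↦ ?_⟩
  have hextend (b : A) : Function.extend Subtype.val c 0 (b : E) = c b :=
    Subtype.val_injective.extend_apply c 0 b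
  have hcell := (ENNReal.toReal_le_toReal (measure_ne_top Q _) (measure_ne_top P _)).1 (hc ⟨a, ha⟩)
  refine hcell.trans (measure_mono fun x hx b hb ↦ ?_)
  rw [hextend ⟨a, ha⟩, hextend ⟨b, hb⟩]
  exact hx ⟨b, hb⟩

theorem exists_isMaxSlopeOn_map_eq {n : ℕ} {P Q : Measure (Rn n)} [IsProbabilityMeasure P]
    [IsProbabilityMeasure Q] (hP : P ≪ volume) {F : Set (Rn n)} (hF : F.Finite)
    (hQ : ∀ᵐ a ∂Q, a ∈ F) :
    ∃ (T : Rn n → Rn n) (c : Rn n → ℝ), (∀ x, T x ∈ F) ∧ IsMaxSlopeOn T c univ ∧ P.map T = Q := by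
  obtain ⟨A, hA⟩ := (hF.subset (sep_subset F fun a ↦ Q {a} ≠ 0)).exists_finset
  have hQA : ∀ᵐ a ∂Q, a ∈ A := by
    filter_upwards [hQ, ae_measure_singleton_ne_zero hF.countable hQ] with a haF ha
      using (hA a).2 ⟨haF, ha⟩
  obtain ⟨c, hc⟩ := exists_forall_measure_singleton_le_measure_cell P
    (fun a ha ↦ ((hA a).1 ha).2) hQA
  obtain ⟨T, hTA, hTmax, hT⟩ :=
    exists_isMaxSlopeOn_univ A.finite_toSet (hQA.exists.imp fun _ h ↦ h) c
  have hTm : AEMeasurable T P := (hT.isGradientTransport hP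
    (A.finite_toSet.subset (image_subset_iff.2 fun x _ ↦ hTA x)) (by simp)).aemeasurable
  have := Measure.isProbabilityMeasure_map hTm
  refine ⟨T, c, fun x ↦ ((hA _).1 (hTA x)).1, hT,
    (eq_of_forall_measure_singleton_le A.countable_toSet hQA fun a ha ↦ ?_).symm⟩
  rw [Measure.map_apply_of_aemeasurable hTm (measurableSet_singleton a)]
  refine (hc a ha).trans (measure_mono_ae ?_)
  filter_upwards [hP.ae_le (ae_injOn_inner_add A.countable_toSet c)] with x hinj hx
  exact hinj (hTA x) ha ((hx _ (hTA x)).antisymm (hTmax x a ha))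

end SemidiscreteTransport

section AdherentValue

variable {Ω X A : Type*} [TopologicalSpace X] {h : Ω → X} {g : Ω → A} {F F' : Set A}
  {K K' : Set X} {x : X}

/-- `a` is a limit value at `x` of the correspondence `g ∘ h⁻¹`. Only the argument passes to the
limit: `x` is a limit of points `h u` with `g u` equal to `a`, which is all that matters when `g`
takes finitely many values. -/
def IsAdherentValue (h : Ω → X) (g : Ω → A) (x : X) (a : A) : Prop :=
  x ∈ closure (h '' (g ⁻¹' {a}))

theorem isAdherentValue_apply (h : Ω → X) (g : Ω → A) (u : Ω) : IsAdherentValue h g (h u) (g u) :=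
  subset_closure ⟨u, rfl, rfl⟩

theorem exists_isAdherentValue (hF : F.Finite) (hx : x ∈ closure (h '' (g ⁻¹' F))) :
    ∃ a ∈ F, IsAdherentValue h g x a := by
  have hunion : h '' (g ⁻¹' F) = ⋃ a ∈ F, h '' (g ⁻¹' {a}) := by
    simp only [← image_iUnion, ← preimage_iUnion, biUnion_of_singleton]
  rw [hunion, hF.closure_biUnion] at hx
  simpa only [IsAdherentValue, mem_iUnion₂, exists_prop] using hx

theorem exists_forall_isAdherentValue [Nonempty A] (hF : F.Finite) (hF' : F'.Finite)
    (hK : K ⊆ closure (h '' (g ⁻¹' F))) (hK' : K' ⊆ closure (h '' (g ⁻¹' F'))) :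
    ∃ d : X → A, MapsTo d K (F ∪ F') ∧ MapsTo d K' F' ∧
      ∀ x ∈ K ∪ K', IsAdherentValue h g x (d x) := by
  have hex : ∀ x ∈ K ∪ K', ∃ a ∈ F ∪ F', (x ∈ K' → a ∈ F') ∧ IsAdherentValue h g x a := by
    intro x hx
    by_cases hxK' : x ∈ K'
    · obtain ⟨a, ha, hxa⟩ := exists_isAdherentValue hF' (hK' hxK')
      exact ⟨a, .inr ha, fun _ ↦ ha, hxa⟩
    · obtain ⟨a, ha, hxa⟩ := exists_isAdherentValue hF (hK (hx.resolve_right hxK'))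
      exact ⟨a, .inl ha, fun h ↦ absurd h hxK', hxa⟩
  choose! d hdF hdF' hd using hex
  exact ⟨d, fun x hx ↦ hdF x (.inl hx), fun x hx ↦ hdF' x (.inr hx) hx, hd⟩

end AdherentValue

section CoMonotonePair

variable {Ω E : Type*} [NormedAddCommGroup E] [InnerProductSpace ℝ E] {h g : Ω → E} {d : E → E}
  {F K : Set E} {x y a b : E}

theorem IsAdherentValue.inner_nonneg (hco : ∀ u v, 0 ≤ inner ℝ (h u - h v) (g u - g v))
    (hx : IsAdherentValue h g x a) (hy : IsAdherentValue h g y b) :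
    0 ≤ inner ℝ (a - b) (x - y) := by
  have hcl := map_mem_closure₂ (f := fun x y ↦ inner ℝ (a - b) (x - y)) (u := Ici (0 : ℝ))
    (by fun_prop) hx hy (by
      rintro _ ⟨u, rfl, rfl⟩ _ ⟨v, rfl, rfl⟩
      exact real_inner_comm (g u - g v) (h u - h v) ▸ hco u v)
  rwa [isClosed_Ici.closure_eq] at hcl

variable [FiniteDimensional ℝ E] [MeasurableSpace E] [BorelSpace E] {μ : Measure E}
  [μ.IsAddHaarMeasure]

-- If `a ≠ b` are both adherent at `x` and at `z`, then `x - z` is orthogonal to `a - b`.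
theorem ae_subsingleton_isAdherentValue
    (hco : ∀ u v, 0 ≤ inner ℝ (h u - h v) (g u - g v)) (hF : F.Countable) :
    ∀ᵐ x ∂μ, {a ∈ F | IsAdherentValue h g x a}.Subsingleton := by
  have hpair : ∀ᵐ x ∂μ, ∀ a ∈ F, ∀ b ∈ F,
      IsAdherentValue h g x a → IsAdherentValue h g x b → a = b := by
    refine (ae_ball_iff hF).2 fun a _ ↦ (ae_ball_iff hF).2 fun b _ ↦ ?_
    by_cases hz : a = b ∨ ∀ z, IsAdherentValue h g z a → ¬IsAdherentValue h g z b
    · exact .of_forall fun x hxa hxb ↦ hz.resolve_right fun hz ↦ hz x hxa hxb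
    push Not at hz
    obtain ⟨hab, z, hza, hzb⟩ := hz
    filter_upwards [ae_inner_ne (sub_ne_zero.2 hab) (inner ℝ (a - b) z)] with x hx hxa hxb
    have hxz := hxa.inner_nonneg hco hzb
    have hzx := hza.inner_nonneg hco hxb
    rw [inner_sub_right, sub_nonneg] at hxz hzx
    exact absurd (hzx.antisymm hxz) hx
  exact hpair.mono fun x hx a ha b hb ↦ hx a ha.1 b hb.1 ha.2 hb.2

variable [MeasurableSpace Ω] {ν : Measure Ω}

theorem ae_comp_eq_of_isAdherentValue (hco : ∀ u v, 0 ≤ inner ℝ (h u - h v) (g u - g v))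
    (hh : AEMeasurable h ν) (hν : ν.map h ≪ μ) (hF : F.Countable) (hg : ∀ᵐ u ∂ν, g u ∈ F)
    (hK : ∀ᵐ x ∂ν.map h, x ∈ K) (hdF : MapsTo d K F)
    (hd : ∀ x ∈ K, IsAdherentValue h g x (d x)) : ∀ᵐ u ∂ν, d (h u) = g u := by
  filter_upwards [ae_of_ae_map hh (hν.ae_le (ae_subsingleton_isAdherentValue hco hF)),
    ae_of_ae_map hh hK, hg] with u huniq huK hu
  exact huniq ⟨hdF huK, hd _ huK⟩ ⟨hu, isAdherentValue_apply h g u⟩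

end CoMonotonePair

section Transport

variable {n : ℕ} {K F : Set (Rn n)}

theorem isMonotoneTransportOn_of_isAdherentValue {Ω : Type*} [MeasurableSpace Ω] {ν : Measure Ω}
    {h g : Ω → Rn n} {d : Rn n → Rn n} (hco : ∀ u v, 0 ≤ inner ℝ (h u - h v) (g u - g v))
    (hh : AEMeasurable h ν) (hν : ν.map h ≪ volume) (hK : Convex ℝ K)
    (hνK : ∀ᵐ x ∂ν.map h, x ∈ K) (hF : F.Finite) (hdF : MapsTo d K F)
    (hd : ∀ x ∈ K, IsAdherentValue h g x (d x)) (hdh : ∀ᵐ u ∂ν, d (h u) = g u) :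
    IsMonotoneTransportOn (ν.map h) (ν.map g) K F d := by
  have hfin : (d '' K).Finite := hF.subset hdF.image_subset
  have hmono : MintyMonotoneOn d K := fun x hx y hy ↦ (hd x hx).inner_nonneg hco (hd y hy)
  obtain ⟨c, hc⟩ := hmono.exists_isMaxSlopeOn hK hfin
  have hdm : AEMeasurable d (ν.map h) := (hc.isGradientTransport hν hfin hνK).aemeasurable
  refine ⟨hdF, hc.isSubgradientOn.cyclicallyMonotoneOn, hdm, ?_⟩
  rw [AEMeasurable.map_map_of_aemeasurable hdm hh]
  exact Measure.map_congr hdh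

theorem exists_isMonotoneTransportOn {P Q : Measure (Rn n)} [IsProbabilityMeasure P]
    [IsProbabilityMeasure Q] (hP : P ≪ volume) (hF : F.Finite) (hQ : ∀ᵐ a ∂Q, a ∈ F)
    (K : Set (Rn n)) : ∃ T, IsMonotoneTransportOn P Q K F T := by
  obtain ⟨T, c, hTF, hc, hT⟩ := exists_isMaxSlopeOn_map_eq hP hF hQ
  have hfin : (T '' univ).Finite := hF.subset (image_subset_iff.2 fun x _ ↦ hTF x)
  exact ⟨T, fun x _ ↦ hTF x, (hc.mono (subset_univ K)).isSubgradientOn.cyclicallyMonotoneOn,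
    (hc.isGradientTransport hP hfin (.of_forall mem_univ)).aemeasurable, hT⟩

end Transport

theorem theorem3_general {Ω : Type*} [MeasurableSpace Ω] {n : ℕ} (ν νs : Measure Ω)
    [IsFiniteMeasure ν] [IsProbabilityMeasure νs] (h0 h1 : Ω → Rn n)
    (hm0 : Measurable h0) (hm1 : Measurable h1) (K0 K0s F1 F1d : Set (Rn n))
    (hK0 : Convex ℝ K0) (hμK0 : IsSupportedOn (ν.map h0) K0) (hac0 : ν.map h0 ≪ volume)
    (hK0s : Convex ℝ K0s) (hμK0s : IsSupportedOn (νs.map h0) K0s) (hac0s : νs.map h0 ≪ volume)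
    (hF1 : F1.Finite) (hμF1 : ν.map h1 F1ᶜ = 0) (hF1d : F1d.Finite) (hμF1d : νs.map h1 F1dᶜ = 0)
    (hco : ∀ u v, 0 ≤ inner ℝ (h0 u - h0 v) (h1 u - h1 v)) :
    (∃ d : Rn n → Rn n, (∀ᵐ u ∂ν, d (h0 u) = h1 u) ∧ (∀ᵐ u ∂νs, d (h0 u) = h1 u) ∧
      IsMonotoneTransportOn (νs.map h0) (νs.map h1) K0s F1d d ∧
      (∀ d', IsMonotoneTransportOn (νs.map h0) (νs.map h1) K0s F1d d' → d' =ᵐ[νs.map h0] d) ∧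
      IsBrenierMap (νs.map h0) (νs.map h1) d ∧ IsBrenierMap (ν.map h0) (ν.map h1) d ∧
      ∀ C φ, IsBrenierPotential (ν.map h0) (ν.map h1) C φ →
        ∀ᵐ x ∂νs.map h0, x ∈ K0 → ∇ φ x = d x) ∧
    ∀ (P : Measure (Rn n)) [IsProbabilityMeasure P] (K : Set (Rn n)), Convex ℝ K → P Kᶜ = 0 →
      P ≪ volume → ∃ T : Rn n → Rn n, IsMonotoneTransportOn P (νs.map h1) K F1d T ∧
        (∀ T', IsMonotoneTransportOn P (νs.map h1) K F1d T' → T' =ᵐ[P] T) ∧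
        IsBrenierMap P (νs.map h1) T := by
  have : IsProbabilityMeasure (νs.map h1) := Measure.isProbabilityMeasure_map hm1.aemeasurable
  have mem_K0 : ∀ᵐ x ∂ν.map h0, x ∈ K0 := mem_ae_iff.2 hμK0.1
  have mem_K0s : ∀ᵐ x ∂νs.map h0, x ∈ K0s := mem_ae_iff.2 hμK0s.1
  have mem_F1 : ∀ᵐ u ∂ν, h1 u ∈ F1 := ae_of_ae_map hm1.aemeasurable (mem_ae_iff.2 hμF1)
  have mem_F1d : ∀ᵐ u ∂νs, h1 u ∈ F1d := ae_of_ae_map hm1.aemeasurable (mem_ae_iff.2 hμF1d)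
  have hF := hF1.union hF1d
  refine ⟨?_, fun P _ K hK hPK hP ↦ ?_⟩
  · obtain ⟨d, hdF, hdF1d, hd⟩ := exists_forall_isAdherentValue hF1 hF1d
      (hμK0.2.trans (support_map_subset_closure_image hm0.aemeasurable mem_F1))
      (hμK0s.2.trans (support_map_subset_closure_image hm0.aemeasurable mem_F1d))
    have hdν := ae_comp_eq_of_isAdherentValue hco hm0.aemeasurable hac0 hF.countable
      (mem_F1.mono fun _ ↦ .inl) mem_K0 hdF fun x hx ↦ hd x (.inl hx)
    have hdνs := ae_comp_eq_of_isAdherentValue hco hm0.aemeasurable hac0s hF1d.countable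
      mem_F1d mem_K0s hdF1d fun x hx ↦ hd x (.inr hx)
    have control := isMonotoneTransportOn_of_isAdherentValue hco hm0.aemeasurable hac0 hK0 mem_K0
      hF hdF (fun x hx ↦ hd x (.inl hx)) hdν
    have treatment := isMonotoneTransportOn_of_isAdherentValue hco hm0.aemeasurable hac0s hK0s
      mem_K0s hF1d hdF1d (fun x hx ↦ hd x (.inr hx)) hdνs
    exact ⟨d, hdν, hdνs, treatment, fun d' hd' ↦ hd'.ae_eq hac0s hK0s mem_K0s hF1d treatment,
      treatment.isBrenierMap hac0s hK0s mem_K0s hF1d, control.isBrenierMap hac0 hK0 mem_K0 hF,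
      fun C φ hφ ↦ hac0s.ae_le (control.ae_gradient_eq hac0 hK0 hμK0 hF hφ)⟩
  · obtain ⟨T, hT⟩ := exists_isMonotoneTransportOn hP hF1d (mem_ae_iff.2 hμF1d) K
    exact ⟨T, hT, fun T' hT' ↦ hT'.ae_eq hP hK (mem_ae_iff.2 hPK) hF1d hT,
      hT.isBrenierMap hP hK (mem_ae_iff.2 hPK) hF1d⟩

theorem theorem3 {n : ℕ}
    -- latent laws and production functions
    (ν νs : Measure (Rn n)) [IsProbabilityMeasure ν] [IsProbabilityMeasure νs]
    (h0 h1 h1s : Rn n → Rn n)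
    (hm0 : Measurable h0) (hm1 : Measurable h1) (hm1s : Measurable h1s)
    -- laws of the outcomes
    (μ0 μ1 μ0s μ1s μ1d : Measure (Rn n))
    (hμ0 : μ0 = ν.map h0) (hμ1 : μ1 = ν.map h1)
    (hμ0s : μ0s = νs.map h0) (hμ1s : μ1s = νs.map h1s) (hμ1d : μ1d = νs.map h1)
    (K0 K0s F1 F1d : Set (Rn n))
    -- (A.1)
    (hK0 : Convex ℝ K0) (hμK0 : IsSupportedOn μ0 K0) (hac0 : μ0 ≪ volume)
    (hK0s : Convex ℝ K0s) (hμK0s : IsSupportedOn μ0s K0s) (hac0s : μ0s ≪ volume)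
    -- (A.2)
    (hF1 : F1.Finite) (hμF1 : μ1 F1ᶜ = 0) (hF1d : F1d.Finite) (hμF1d : μ1d F1dᶜ = 0)
    -- (A.3)
    (hco : CoMonotone h0 h1) (hwd : CompInvWellDefined h1 h0) :
    (∃ d : Rn n → Rn n,
      -- `d` is the natural drift `h1 ∘ h0⁻¹`, in the control and in the treatment group
      (∀ᵐ u ∂ν, d (h0 u) = h1 u) ∧ (∀ᵐ u ∂νs, d (h0 u) = h1 u) ∧
      -- `d : K0s → F1d` pushes `μ0s` to `μ1d`, and is the unique such map
      IsMonotoneTransportOn μ0s μ1d K0s F1d d ∧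
      (∀ d', IsMonotoneTransportOn μ0s μ1d K0s F1d d' → d' =ᵐ[μ0s] d) ∧
      IsBrenierMap μ0s μ1d d ∧
      -- `d` is the Brenier map from `μ0` to `μ1`, and on `K0` also `μ0s`-almost everywhere
      IsBrenierMap μ0 μ1 d ∧
      (∀ C φ, IsBrenierPotential μ0 μ1 C φ → ∀ᵐ x ∂μ0s, x ∈ K0 → ∇ φ x = d x)) ∧
    (∀ K1s : Set (Rn n),
      -- (A.4)
      CoMonotone h0 h1s → CompInvWellDefined h1s h0 →
      -- (A.5)
      Convex ℝ K1s → IsSupportedOn μ1s K1s → μ1s ≪ volume →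
      ∃ T : Rn n → Rn n,
        IsMonotoneTransportOn μ1s μ1d K1s F1d T ∧
        (∀ T', IsMonotoneTransportOn μ1s μ1d K1s F1d T' → T' =ᵐ[μ1s] T) ∧
        IsBrenierMap μ1s μ1d T) := by
  subst hμ0 hμ1 hμ0s hμ1s hμ1d
  have := Measure.isProbabilityMeasure_map (μ := νs) hm1s.aemeasurable
  exact (theorem3_general ν νs h0 h1 hm0 hm1 K0 K0s F1 F1d hK0 hμK0 hac0 hK0s hμK0s hac0s hF1 hμF1
    hF1d hμF1d hco).imp_right fun transport K1s _ _ hK1s hμK1s hac1s ↦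
      transport _ K1s hK1s hμK1s.1 hac1s
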